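/- Let $\Bbbk$ be a field, $n, d \ge 0$ integers, $P=\Bbbk[x_1,\dots,x_n]$ with the standard grading, and $Q=P/(x_1^2,\dots,x_n^2)$ the Kruskal–Katona ring with the induced grading. Let $A$ be one of the graded rings $P$, $Q$. For a homogeneous ideal $I\subseteq A$, let $H(I,j)=\dim_{\Bbbk} I_j$ be the dimension of its degree-$j$ component. An ideal $I \subseteq A$ is called $d$-Gotzmann if it is homogeneous, generated by elements of degree $d$, and satisfies \[ H(I,d+1)\le H(J,d+1)\quad\text{for every homogeneous ideal } J\subseteq A \text{ with } H(J,d)=H(I,d). \] If $I\subseteq P$ is a $d$-Gotzmann ideal of $P$ that is generated by square-free monomials, then the image of $I$ in $Q$ is a $d$-Gotzmann ideal of $Q$. -/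

import Mathlib

open MvPolynomial

attribute [local instance] MvPolynomial.gradedAlgebra

namespace Gotzmann

section General

variable {k A : Type*} [Field k] [CommRing A] [Algebra k A]

/-- The Hilbert function `H(I, d) = dim_k I_d` of an ideal `I` of a graded `k`-algebra
`A = ⨁ 𝒜 d`, where `I_d = I ∩ 𝒜 d`. -/
noncomputable def hilbertFunction (𝒜 : ℕ → Submodule k A) (I : Ideal A) (d : ℕ) : ℕ :=
  Module.finrank k (I.restrictScalars k ⊓ 𝒜 d : Submodule k A)

/-- The ideal `I` is generated by elements that are homogeneous of degree `d`. -/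
def IsGeneratedInDegree (𝒜 : ℕ → Submodule k A) (d : ℕ) (I : Ideal A) : Prop :=
  ∃ S : Set A, S ⊆ 𝒜 d ∧ I = Ideal.span S

/-- `I` is a `d`-Gotzmann ideal of the graded algebra `A = ⨁ 𝒜 d`: a homogeneous ideal generated
in degree `d` such that `H(I, d + 1) ≤ H(J, d + 1)` for all homogeneous ideals `J` of `A`
with `H(I, d) = H(J, d)`. -/
def IsGotzmann (𝒜 : ℕ → Submodule k A) [GradedAlgebra 𝒜] (d : ℕ) (I : Ideal A) : Prop :=
  I.IsHomogeneous 𝒜 ∧ IsGeneratedInDegree 𝒜 d I ∧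
    ∀ J : Ideal A, J.IsHomogeneous 𝒜 →
      hilbertFunction 𝒜 I d = hilbertFunction 𝒜 J d →
        hilbertFunction 𝒜 I (d + 1) ≤ hilbertFunction 𝒜 J (d + 1)

/-- The grading induced on a quotient `A ⧸ I`: the degree `d` part is the image of `𝒜 d`. -/
def quotientGrading (𝒜 : ℕ → Submodule k A) (I : Ideal A) (d : ℕ) : Submodule k (A ⧸ I) :=
  (𝒜 d).map (Ideal.Quotient.mkₐ k I).toLinearMap

theorem mk_mem_quotientGrading (𝒜 : ℕ → Submodule k A) (I : Ideal A) {d : ℕ} {a : A}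
    (ha : a ∈ 𝒜 d) : Ideal.Quotient.mk I a ∈ quotientGrading 𝒜 I d :=
  ⟨a, ha, rfl⟩

instance quotientGrading_gradedMonoid (𝒜 : ℕ → Submodule k A) [GradedAlgebra 𝒜] (I : Ideal A) :
    SetLike.GradedMonoid (quotientGrading 𝒜 I) where
  one_mem := ⟨1, SetLike.GradedOne.one_mem, map_one (Ideal.Quotient.mk I)⟩
  mul_mem := by
    rintro i j _ _ ⟨a, ha, rfl⟩ ⟨b, hb, rfl⟩
    exact ⟨a * b, SetLike.GradedMul.mul_mem ha hb, map_mul (Ideal.Quotient.mk I) a b⟩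

/-- Auxiliary map: decompose in `A`, then reduce each component modulo `I`. -/
noncomputable def preDecompose (𝒜 : ℕ → Submodule k A) [GradedAlgebra 𝒜] (I : Ideal A) :
    A →+ DirectSum ℕ (fun i => quotientGrading 𝒜 I i) :=
  (DirectSum.toAddMonoid fun i =>
    (DirectSum.of (fun i => quotientGrading 𝒜 I i) i).comp
      (AddMonoidHom.mk' (fun a : 𝒜 i =>
        (⟨Ideal.Quotient.mk I a, mk_mem_quotientGrading 𝒜 I a.2⟩ : quotientGrading 𝒜 I i))
        (fun a b => Subtype.ext (map_add (Ideal.Quotient.mk I) (a : A) (b : A))))).comp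
    (DirectSum.decomposeAddEquiv 𝒜).toAddMonoidHom

theorem preDecompose_of_mem (𝒜 : ℕ → Submodule k A) [GradedAlgebra 𝒜] (I : Ideal A) {i : ℕ}
    {a : A} (ha : a ∈ 𝒜 i) :
    preDecompose 𝒜 I a = DirectSum.of (fun i => quotientGrading 𝒜 I i) i
      ⟨Ideal.Quotient.mk I a, mk_mem_quotientGrading 𝒜 I ha⟩ := by
  simp [preDecompose, DirectSum.decompose_of_mem 𝒜 ha]

theorem preDecompose_eq_zero (𝒜 : ℕ → Submodule k A) [GradedAlgebra 𝒜] (I : Ideal A)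
    (hI : I.IsHomogeneous 𝒜) {a : A} (ha : a ∈ I) : preDecompose 𝒜 I a = 0 := by
  classical
  rw [← DirectSum.sum_support_decompose 𝒜 a, map_sum]
  refine Finset.sum_eq_zero fun i _ => ?_
  rw [preDecompose_of_mem 𝒜 I (SetLike.coe_mem (DirectSum.decompose 𝒜 a i))]
  convert map_zero (DirectSum.of (fun i => quotientGrading 𝒜 I i) i) using 2
  exact Subtype.ext (Ideal.Quotient.eq_zero_iff_mem.2 (hI i ha))

/-- The decomposition map of the quotient of a graded algebra by a homogeneous ideal. -/
noncomputable def quotientDecompose (𝒜 : ℕ → Submodule k A) [GradedAlgebra 𝒜] (I : Ideal A)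
    (hI : I.IsHomogeneous 𝒜) : A ⧸ I →+ DirectSum ℕ (fun i => quotientGrading 𝒜 I i) :=
  QuotientAddGroup.lift (Submodule.toAddSubgroup I) (preDecompose 𝒜 I)
    (fun _ ha => preDecompose_eq_zero 𝒜 I hI ha)

theorem quotientDecompose_mk (𝒜 : ℕ → Submodule k A) [GradedAlgebra 𝒜] (I : Ideal A)
    (hI : I.IsHomogeneous 𝒜) (a : A) :
    quotientDecompose 𝒜 I hI (Ideal.Quotient.mk I a) = preDecompose 𝒜 I a :=
  rfl

/-- The quotient of a graded algebra by a homogeneous ideal is graded. -/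
noncomputable abbrev quotientGradedAlgebra (𝒜 : ℕ → Submodule k A) [GradedAlgebra 𝒜]
    (I : Ideal A) (hI : I.IsHomogeneous 𝒜) : GradedAlgebra (quotientGrading 𝒜 I) where
  toDecomposition := DirectSum.Decomposition.ofAddHom (quotientGrading 𝒜 I)
    (quotientDecompose 𝒜 I hI)
    (by
      classical
      ext q
      obtain ⟨a, rfl⟩ := Ideal.Quotient.mk_surjective q
      rw [AddMonoidHom.comp_apply, quotientDecompose_mk, AddMonoidHom.id_apply]
      conv_rhs => rw [← DirectSum.sum_support_decompose 𝒜 a]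
      conv_lhs => rw [← DirectSum.sum_support_decompose 𝒜 a]
      simp only [map_sum]
      refine Finset.sum_congr rfl fun i _ => ?_
      rw [preDecompose_of_mem 𝒜 I (SetLike.coe_mem (DirectSum.decompose 𝒜 a i)),
        DirectSum.coeAddMonoidHom_of])
    (by
      refine DirectSum.addHom_ext fun i x => ?_
      obtain ⟨_, a, ha, rfl⟩ := x
      rw [AddMonoidHom.comp_apply, DirectSum.coeAddMonoidHom_of]
      exact preDecompose_of_mem 𝒜 I ha)

end General

section KruskalKatonaRing

variable (k : Type*) [Field k] (n : ℕ)

/-- The ideal `(x_1 ^ 2, …, x_n ^ 2)` of `k[x_1, …, x_n]`. -/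
noncomputable def squaresIdeal : Ideal (MvPolynomial (Fin n) k) :=
  Ideal.span (Set.range fun i : Fin n => (X i : MvPolynomial (Fin n) k) ^ 2)

theorem squaresIdeal_isHomogeneous :
    (squaresIdeal k n).IsHomogeneous (homogeneousSubmodule (Fin n) k) := by
  refine Ideal.homogeneous_span _ _ ?_
  rintro _ ⟨i, rfl⟩
  exact ⟨2, isHomogeneous_X_pow i 2⟩

/-- The Kruskal-Katona ring `Q = k[x_1, …, x_n] / (x_1 ^ 2, …, x_n ^ 2)`. -/
abbrev KruskalKatonaRing : Type _ := MvPolynomial (Fin n) k ⧸ squaresIdeal k n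

/-- The standard grading of the Kruskal-Katona ring. -/
noncomputable abbrev kruskalKatonaGrading : ℕ → Submodule k (KruskalKatonaRing k n) :=
  quotientGrading (homogeneousSubmodule (Fin n) k) (squaresIdeal k n)

noncomputable instance kruskalKatonaGradedAlgebra : GradedAlgebra (kruskalKatonaGrading k n) :=
  quotientGradedAlgebra _ _ (squaresIdeal_isHomogeneous k n)

variable {k n}

/-- `I` is generated by square-free monomials `∏_{i ∈ F} x_i`. -/
def IsSquarefreeMonomialIdeal (I : Ideal (MvPolynomial (Fin n) k)) : Prop :=
  ∃ S : Set (Finset (Fin n)),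
    I = Ideal.span ((fun F : Finset (Fin n) => ∏ i ∈ F, (X i : MvPolynomial (Fin n) k)) '' S)

end KruskalKatonaRing

end Gotzmann

/-!
Let `I ⊆ P` be generated by the square-free monomials `x^F`, `F ∈ T`, for a family `T` of `d`-sets
with upper shadow `∂⁺ T`. A monomial of degree `d + 1` in `I` is either square-free, hence `x^G`
with `G ∈ ∂⁺ T`, or of the form `x^F * x_i` with `i ∈ F ∈ T`, where `F` and `i` are determined by
the monomial. So `H(I, d + 1) = d * #T + #(∂⁺ T)`, whereas the image of `I` in `Q` has Hilbert
function `#(∂⁺ T)` in degree `d + 1`. If `I` is `d`-Gotzmann, comparing it with the square-free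
ideals of the other families shows that `∂⁺ T` is smallest among the upper shadows of families of
`#T` sets of size `d`.

An arbitrary ideal `J` of `Q` is compared with the families of its square-free leading monomials in
degrees `d` and `d + 1`. As every monomial that is not square-free lies in the ideal of squares,
these families have `H(J, d)` and `H(J, d + 1)` members, and the second one contains the upper
shadow of the first.
-/

namespace Gotzmann

section GradedIdeals

variable {k A : Type*} [Field k] [CommRing A] [Algebra k A] {𝒜 : ℕ → Submodule k A} {d : ℕ}
  {I : Ideal A}

theorem IsGeneratedInDegree.isHomogeneous [GradedAlgebra 𝒜] (hI : IsGeneratedInDegree 𝒜 d I) :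
    I.IsHomogeneous 𝒜 := by
  obtain ⟨S, hS, rfl⟩ := hI
  exact Ideal.homogeneous_span _ _ fun a ha => ⟨d, hS ha⟩

theorem IsGeneratedInDegree.map_mk (hI : IsGeneratedInDegree 𝒜 d I) (K : Ideal A) :
    IsGeneratedInDegree (quotientGrading 𝒜 K) d (I.map (Ideal.Quotient.mk K)) := by
  obtain ⟨S, hS, rfl⟩ := hI
  refine ⟨Ideal.Quotient.mk K '' S, ?_, Ideal.map_span _ _⟩
  rintro _ ⟨a, ha, rfl⟩
  exact mk_mem_quotientGrading 𝒜 K (hS ha)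

theorem hilbertFunction_quotientGrading_add (K : Ideal A) (J : Ideal (A ⧸ K)) (j : ℕ)
    [Module.Finite k (𝒜 j)] :
    hilbertFunction (quotientGrading 𝒜 K) J j + hilbertFunction 𝒜 K j =
      hilbertFunction 𝒜 (J.comap (Ideal.Quotient.mk K)) j := by
  set π : A →ₗ[k] A ⧸ K := (Ideal.Quotient.mkₐ k K).toLinearMap
  set U : Submodule k A :=
    (J.comap (Ideal.Quotient.mk K)).restrictScalars k ⊓ 𝒜 j with hU
  have : Module.Finite k U := Submodule.finiteDimensional_of_le inf_le_right
  have map_eq : U.map π = J.restrictScalars k ⊓ quotientGrading 𝒜 K j := by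
    rw [inf_comm, quotientGrading, Submodule.map_inf_eq_map_inf_comap, inf_comm]
    rfl
  have inf_ker_eq : U ⊓ LinearMap.ker π = K.restrictScalars k ⊓ 𝒜 j := by
    have ker_eq : LinearMap.ker π = K.restrictScalars k := by
      ext a
      exact Ideal.Quotient.eq_zero_iff_mem
    have le_comap : K.restrictScalars k ≤ (J.comap (Ideal.Quotient.mk K)).restrictScalars k :=
      Ideal.mk_ker.ge.trans (Ideal.ker_le_comap _)
    rw [ker_eq, hU, inf_right_comm, inf_eq_right.2 le_comap]
  have rank_nullity := (π.domRestrict U).finrank_range_add_finrank_ker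
  rwa [LinearMap.range_domRestrict, map_eq, LinearMap.ker_domRestrict,
    ← Submodule.finrank_map_subtype_eq, Submodule.map_comap_subtype, inf_ker_eq] at rank_nullity

end GradedIdeals

section LeadingExponents

open scoped Pointwise

variable {σ R : Type*} [CommSemiring R] (m : MonomialOrder σ)

/-- The set of leading exponents of the nonzero elements of a space `U` of polynomials; for an
ideal these are the exponents of its initial ideal. -/
def leadingExponents (U : Submodule R (MvPolynomial σ R)) : Set (σ →₀ ℕ) :=
  m.degree '' {f | f ∈ U ∧ f ≠ 0}

theorem leadingExponents_mono {U V : Submodule R (MvPolynomial σ R)} (h : U ≤ V) :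
    leadingExponents m U ⊆ leadingExponents m V :=
  Set.image_mono fun _ hf => ⟨h hf.1, hf.2⟩

theorem leadingExponents_restrictSupport [Nontrivial R] (s : Set (σ →₀ ℕ)) :
    leadingExponents m (restrictSupport R s) = s := by
  classical
  refine Set.Subset.antisymm ?_ fun a ha => ⟨monomial a 1, ⟨?_, ?_⟩, ?_⟩
  · rintro _ ⟨f, ⟨hf, hf0⟩, rfl⟩
    exact hf (m.degree_mem_support hf0)
  · exact (monomial_mem_restrictSupport R).2 (Or.inl ha)
  · simp
  · simp [m.degree_monomial]

theorem leadingExponents_add_subset_mul [NoZeroDivisors R] (U V : Submodule R (MvPolynomial σ R)) :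
    leadingExponents m U + leadingExponents m V ⊆ leadingExponents m (U * V) := by
  rintro _ ⟨_, ⟨f, ⟨hf, hf0⟩, rfl⟩, _, ⟨g, ⟨hg, hg0⟩, rfl⟩, rfl⟩
  exact ⟨f * g, ⟨Submodule.mul_mem_mul hf hg, mul_ne_zero hf0 hg0⟩, m.degree_mul hf0 hg0⟩

theorem leadingExponents_homogeneousSubmodule [Nontrivial R] (j : ℕ) :
    leadingExponents m (homogeneousSubmodule σ R j) = {a | a.degree = j} := by
  rw [homogeneousSubmodule_eq_finsupp_supported]
  exact leadingExponents_restrictSupport m _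

theorem degree_eq_of_mem_leadingExponents [Nontrivial R] {I : Ideal (MvPolynomial σ R)} {j : ℕ}
    {a : σ →₀ ℕ}
    (ha : a ∈ leadingExponents m (I.restrictScalars R ⊓ homogeneousSubmodule σ R j)) :
    a.degree = j :=
  (leadingExponents_homogeneousSubmodule m j).subset (leadingExponents_mono m inf_le_right ha)

theorem add_mem_leadingExponents [Nontrivial R] [NoZeroDivisors R]
    {I : Ideal (MvPolynomial σ R)} {i j : ℕ} {a b : σ →₀ ℕ}
    (ha : a ∈ leadingExponents m (I.restrictScalars R ⊓ homogeneousSubmodule σ R i))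
    (hb : b.degree = j) :
    a + b ∈ leadingExponents m (I.restrictScalars R ⊓ homogeneousSubmodule σ R (i + j)) := by
  have hb := (leadingExponents_homogeneousSubmodule (R := R) m j).superset hb
  refine leadingExponents_mono m ?_ (leadingExponents_add_subset_mul m _ _ (Set.add_mem_add ha hb))
  exact Submodule.mul_le.2 fun f hf g hg => ⟨I.mul_mem_right g hf.1, IsHomogeneous.mul hf.2 hg⟩

/-- The coefficients of a polynomial at the leading exponents of a space `U` of polynomials
containing it. They serve as coordinates on `U`. -/
noncomputable def leadingCoordinates (U : Submodule R (MvPolynomial σ R)) :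
    U →ₗ[R] leadingExponents m U →₀ R :=
  Finsupp.lsubtypeDomain _ ∘ₗ (basisMonomials σ R).repr.toLinearMap ∘ₗ U.subtype

variable {m}

theorem leadingCoordinates_injective {S : Type*} [CommRing S]
    {U : Submodule S (MvPolynomial σ S)} : Function.Injective (leadingCoordinates m U) := by
  rw [injective_iff_map_eq_zero]
  intro f hf
  by_contra hf0
  have hf0' : (f : MvPolynomial σ S) ≠ 0 := by simpa using hf0
  exact m.coeff_degree_ne_zero_iff.2 hf0'
    (DFunLike.congr_fun hf ⟨m.degree f.1, f, ⟨f.2, hf0'⟩, rfl⟩)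

variable {k : Type*} [Field k] {U : Submodule k (MvPolynomial σ k)}

theorem single_mem_range_leadingCoordinates (a : leadingExponents m U) :
    Finsupp.single a 1 ∈ LinearMap.range (leadingCoordinates m U) := by
  classical
  induction a using (InvImage.wf (fun a : leadingExponents m U => m.toSyn a.1)
    wellFounded_lt).induction with
  | _ a ih =>
  obtain ⟨_, f, ⟨hfU, hf0⟩, rfl⟩ := a
  set a : leadingExponents m U := ⟨m.degree f, f, ⟨hfU, hf0⟩, rfl⟩
  set c := leadingCoordinates m U ⟨f, hfU⟩
  have hca : c a ≠ 0 := m.coeff_degree_ne_zero_iff.2 hf0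
  have lower_terms : c.erase a ∈ LinearMap.range (leadingCoordinates m U) := by
    rw [← Finsupp.sum_single (c.erase a)]
    refine Submodule.sum_mem _ fun b hb => ?_
    rw [Finsupp.support_erase, Finset.mem_erase, Finsupp.mem_support_iff] at hb
    rw [← Finsupp.smul_single_one]
    refine Submodule.smul_mem _ _ (ih b (lt_of_le_of_ne ?_ ?_))
    · exact m.le_degree (mem_support_iff.2 hb.2)
    · exact fun h => hb.1 (Subtype.ext (m.toSyn.injective h))
  have leading_term : c a • Finsupp.single a 1 ∈ LinearMap.range (leadingCoordinates m U) := by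
    rw [Finsupp.smul_single_one, eq_sub_of_add_eq (Finsupp.single_add_erase a c)]
    exact Submodule.sub_mem _ (LinearMap.mem_range_self _ _) lower_terms
  exact (Submodule.smul_mem_iff _ hca).1 leading_term

theorem leadingCoordinates_surjective : Function.Surjective (leadingCoordinates m U) := by
  rw [← LinearMap.range_eq_top, eq_top_iff, ← (Finsupp.basisSingleOne (R := k)).span_eq,
    Submodule.span_le, Finsupp.coe_basisSingleOne]
  rintro _ ⟨a, rfl⟩
  exact single_mem_range_leadingCoordinates a

theorem finrank_eq_ncard_leadingExponents (m : MonomialOrder σ)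
    (U : Submodule k (MvPolynomial σ k)) :
    Module.finrank k U = (leadingExponents m U).ncard :=
  Module.finrank_eq_nat_card_basis (Module.Basis.ofRepr (LinearEquiv.ofBijective _
    ⟨leadingCoordinates_injective (m := m) (U := U), leadingCoordinates_surjective⟩))

end LeadingExponents

section MonomialIdeals

theorem restrictScalars_span_monomial_inf_homogeneousSubmodule {σ R : Type*} [CommSemiring R]
    (S : Set (σ →₀ ℕ)) (j : ℕ) :
    (Ideal.span ((fun s => monomial s (1 : R)) '' S)).restrictScalars R ⊓
      homogeneousSubmodule σ R j = restrictSupport R {a | a.degree = j ∧ ∃ s ∈ S, s ≤ a} := by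
  rw [homogeneousSubmodule_eq_finsupp_supported]
  ext f
  exact (and_congr_left' mem_ideal_span_monomial_image).trans
    ⟨fun h a ha => ⟨h.2 ha, h.1 a ha⟩, fun h => ⟨fun a ha => (h ha).2, fun a ha => (h ha).1⟩⟩

variable {σ k : Type*} [Field k]

theorem hilbertFunction_span_monomial (S : Set (σ →₀ ℕ)) (j : ℕ) :
    hilbertFunction (homogeneousSubmodule σ k) (Ideal.span ((fun s => monomial s 1) '' S)) j =
      {a : σ →₀ ℕ | a.degree = j ∧ ∃ s ∈ S, s ≤ a}.ncard := by
  rw [hilbertFunction, restrictScalars_span_monomial_inf_homogeneousSubmodule]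
  exact Module.finrank_eq_nat_card_basis (basisRestrictSupport k _)

theorem IsGeneratedInDegree.span_monomial_eq {S : Set (σ →₀ ℕ)} {d : ℕ}
    (h : IsGeneratedInDegree (homogeneousSubmodule σ k) d
      (Ideal.span ((fun s => monomial s 1) '' S))) :
    Ideal.span ((fun s => monomial s (1 : k)) '' S) =
      Ideal.span ((fun s => monomial s 1) '' {s ∈ S | s.degree = d}) := by
  obtain ⟨B, hB, hSB⟩ := h
  have degree_eq {f a} (hf : f ∈ B) (ha : a ∈ f.support) : a.degree = d := by
    by_contra hne
    exact mem_support_iff.1 ha (IsHomogeneous.coeff_eq_zero (hB hf) hne)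
  have le_degree {s} (hs : s ∈ S) : d ≤ s.degree := by
    have span_le : Ideal.span B ≤
        Ideal.span ((fun s => monomial s 1) '' {s : σ →₀ ℕ | s.degree = d}) :=
      Ideal.span_le.2 fun f hf =>
        mem_ideal_span_monomial_image.2 fun a ha => ⟨a, degree_eq hf ha, le_rfl⟩
    have hsB : monomial s 1 ∈ Ideal.span B := hSB ▸ Ideal.subset_span ⟨s, hs, rfl⟩
    obtain ⟨t, rfl, hts⟩ := mem_ideal_span_monomial_image.1 (span_le hsB) s
      (by classical simp [coeff_monomial])
    exact Finsupp.degree_mono hts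
  refine le_antisymm ?_ (Ideal.span_mono (Set.image_mono fun s hs => hs.1))
  rw [hSB, Ideal.span_le]
  intro f hf
  refine mem_ideal_span_monomial_image.2 fun a ha => ?_
  obtain ⟨s, hs, hsa⟩ :=
    mem_ideal_span_monomial_image.1 (hSB ▸ Ideal.subset_span hf) a ha
  refine ⟨s, ⟨hs, le_antisymm ?_ (le_degree hs)⟩, hsa⟩
  exact degree_eq hf ha ▸ Finsupp.degree_mono hsa

end MonomialIdeals

section SquarefreeMonomials

open Finset
open scoped FinsetFamily

variable {σ : Type*}

/-- The exponent of the square-free monomial `∏ i ∈ F, x_i`, as an order embedding: divisibility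
of square-free monomials is inclusion of their sets of variables. -/
noncomputable def squarefreeExponent : Finset σ ↪o (σ →₀ ℕ) :=
  OrderEmbedding.ofMapLEIff (fun F => ∑ i ∈ F, Finsupp.single i 1) fun F G => by
    classical
    simp only [Finsupp.le_def, Finsupp.finsetSum_apply, Finsupp.single_apply,
      sum_ite_eq', subset_iff]
    refine forall_congr' fun i => ?_
    split_ifs <;> simp_all

theorem squarefreeExponent_apply [DecidableEq σ] (F : Finset σ) (i : σ) :
    squarefreeExponent F i = if i ∈ F then 1 else 0 := by
  simp [squarefreeExponent, Finsupp.finsetSum_apply, Finsupp.single_apply]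

theorem degree_squarefreeExponent (F : Finset σ) : (squarefreeExponent F).degree = #F := by
  simp [squarefreeExponent]

theorem squarefreeExponent_insert [DecidableEq σ] {F : Finset σ} {i : σ} (hi : i ∉ F) :
    squarefreeExponent (insert i F) = squarefreeExponent F + Finsupp.single i 1 :=
  (sum_insert hi).trans (add_comm _ _)

theorem mem_range_squarefreeExponent_iff {a : σ →₀ ℕ} :
    a ∈ Set.range (squarefreeExponent (σ := σ)) ↔ ∀ i, a i ≤ 1 := by
  classical
  refine ⟨?_, fun h => ⟨a.support, Finsupp.ext fun i => ?_⟩⟩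
  · rintro ⟨F, rfl⟩ i
    rw [squarefreeExponent_apply]
    split_ifs <;> norm_num
  · have := h i
    simp only [squarefreeExponent_apply, Finsupp.mem_support_iff]
    split_ifs <;> omega

theorem two_le_squarefreeExponent_add_single_iff {F : Finset σ} {i j : σ} (hi : i ∈ F) :
    2 ≤ (squarefreeExponent F + Finsupp.single i 1 : σ →₀ ℕ) j ↔ j = i := by
  classical
  rw [Finsupp.add_apply, squarefreeExponent_apply, Finsupp.single_apply]
  split_ifs <;> simp_all <;> tauto

theorem injOn_squarefreeExponent_add_single (T : Finset (Finset σ)) :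
    Set.InjOn (fun p : (_ : Finset σ) × σ => squarefreeExponent p.1 + Finsupp.single p.2 1)
      (T.sigma id) := by
  rintro ⟨F, i⟩ hi ⟨G, j⟩ hj h
  have hi := (mem_sigma.1 hi).2
  have hj := (mem_sigma.1 hj).2
  dsimp only [id] at hi hj h
  obtain rfl : i = j := by
    rw [← two_le_squarefreeExponent_add_single_iff hj, ← h,
      two_le_squarefreeExponent_add_single_iff hi]
  rw [squarefreeExponent.injective (add_right_cancel h)]

variable [Fintype σ] [DecidableEq σ] {T : Finset (Finset σ)} {d : ℕ}

theorem degree_eq_succ_and_squarefreeExponent_le_iff (hT : (T : Set (Finset σ)).Sized d)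
    {a : σ →₀ ℕ} :
    (a.degree = d + 1 ∧ ∃ F ∈ T, squarefreeExponent F ≤ a) ↔
      (∃ p ∈ T.sigma id, squarefreeExponent p.1 + Finsupp.single p.2 1 = a) ∨
        ∃ G ∈ ∂⁺ T, squarefreeExponent G = a := by
  constructor
  · rintro ⟨ha, F, hF, hFa⟩
    obtain ⟨b, rfl⟩ := exists_add_of_le hFa
    rw [map_add, degree_squarefreeExponent, hT hF, add_right_inj] at ha
    obtain ⟨i, rfl⟩ : b ∈ Set.range fun i => Finsupp.single i 1 := by
      rw [Finsupp.range_single_one]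
      exact ha
    by_cases hi : i ∈ F
    · exact Or.inl ⟨⟨F, i⟩, mem_sigma.2 ⟨hF, hi⟩, rfl⟩
    · exact Or.inr ⟨insert i F, insert_mem_upShadow hF hi, squarefreeExponent_insert hi⟩
  · rintro (⟨⟨F, i⟩, hp, rfl⟩ | ⟨G, hG, rfl⟩)
    · have hF := (mem_sigma.1 hp).1
      refine ⟨?_, F, hF, le_self_add⟩
      rw [map_add, degree_squarefreeExponent, hT hF, Finsupp.degree_single]
    · obtain ⟨F, hF, hFG, -⟩ := mem_upShadow_iff_exists_mem_card_add_one.1 hG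
      refine ⟨?_, F, hF, squarefreeExponent.monotone hFG⟩
      rw [degree_squarefreeExponent, hT.upShadow hG]

theorem ncard_degree_eq_succ_and_squarefreeExponent_le (hT : (T : Set (Finset σ)).Sized d) :
    {a : σ →₀ ℕ | a.degree = d + 1 ∧ ∃ F ∈ T, squarefreeExponent F ≤ a}.ncard =
      d * #T + #(∂⁺ T) := by
  set raised : Finset (σ →₀ ℕ) := (T.sigma id).image
    fun p => squarefreeExponent p.1 + Finsupp.single p.2 1
  set squarefree : Finset (σ →₀ ℕ) := (∂⁺ T).map squarefreeExponent.toEmbedding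
  have eq_union : {a : σ →₀ ℕ | a.degree = d + 1 ∧ ∃ F ∈ T, squarefreeExponent F ≤ a} =
      ↑(raised ∪ squarefree) := by
    ext a
    rw [mem_coe, mem_union, mem_image, mem_map]
    exact degree_eq_succ_and_squarefreeExponent_le_iff hT
  have disjoint : Disjoint raised squarefree := by
    rw [disjoint_left]
    intro a ha hsq
    obtain ⟨⟨F, i⟩, hp, rfl⟩ := mem_image.1 ha
    obtain ⟨G, -, hG⟩ := mem_map.1 hsq
    refine (mem_range_squarefreeExponent_iff.1 ⟨G, hG⟩ i).not_gt ?_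
    exact (two_le_squarefreeExponent_add_single_iff (mem_sigma.1 hp).2).2 rfl
  have card_raised : #raised = d * #T := by
    rw [card_image_of_injOn (injOn_squarefreeExponent_add_single T), card_sigma, mul_comm]
    exact sum_const_nat fun F hF => hT hF
  rw [eq_union, Set.ncard_coe_finset, card_union_of_disjoint disjoint, card_raised, card_map]

end SquarefreeMonomials

section SquarefreeIdeals

open Finset
open scoped FinsetFamily

/-- The ideal generated by the square-free monomials `∏ i ∈ F, x_i` for `F ∈ S`. -/
noncomputable def squarefreeIdeal {σ : Type*} (R : Type*) [CommSemiring R]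
    (S : Set (Finset σ)) : Ideal (MvPolynomial σ R) :=
  Ideal.span ((fun F => ∏ i ∈ F, X i) '' S)

theorem squarefreeIdeal_eq_span_monomial {σ R : Type*} [CommSemiring R] (S : Set (Finset σ)) :
    squarefreeIdeal R S = Ideal.span ((fun s => monomial s 1) '' (squarefreeExponent '' S)) := by
  rw [squarefreeIdeal, Set.image_image]
  congr 2
  ext1 F
  exact (monomial_sum_one F fun i => Finsupp.single i 1).symm

variable {σ k : Type*} [Field k] {S : Set (Finset σ)} {d : ℕ}

theorem isGeneratedInDegree_squarefreeIdeal (hS : S.Sized d) :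
    IsGeneratedInDegree (homogeneousSubmodule σ k) d (squarefreeIdeal k S) := by
  refine ⟨_, ?_, squarefreeIdeal_eq_span_monomial S⟩
  rintro _ ⟨_, ⟨F, hF, rfl⟩, rfl⟩
  exact isHomogeneous_monomial 1 ((degree_squarefreeExponent F).trans (hS hF))

theorem IsGeneratedInDegree.squarefreeIdeal_eq
    (h : IsGeneratedInDegree (homogeneousSubmodule σ k) d (squarefreeIdeal k S)) :
    squarefreeIdeal k S = squarefreeIdeal k {F ∈ S | #F = d} := by
  rw [squarefreeIdeal_eq_span_monomial] at h ⊢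
  rw [h.span_monomial_eq, squarefreeIdeal_eq_span_monomial]
  congr 2
  ext a
  constructor
  · rintro ⟨⟨F, hF, rfl⟩, hd⟩
    exact ⟨F, ⟨hF, (degree_squarefreeExponent F).symm.trans hd⟩, rfl⟩
  · rintro ⟨F, ⟨hF, hd⟩, rfl⟩
    exact ⟨⟨F, hF, rfl⟩, (degree_squarefreeExponent F).trans hd⟩

theorem hilbertFunction_squarefreeIdeal (S : Set (Finset σ)) (j : ℕ) :
    hilbertFunction (homogeneousSubmodule σ k) (squarefreeIdeal k S) j =
      {a : σ →₀ ℕ | a.degree = j ∧ ∃ F ∈ S, squarefreeExponent F ≤ a}.ncard := by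
  simp only [squarefreeIdeal_eq_span_monomial, hilbertFunction_span_monomial,
    Set.exists_mem_image]

theorem hilbertFunction_squarefreeIdeal_self {T : Finset (Finset σ)}
    (hT : (T : Set (Finset σ)).Sized d) :
    hilbertFunction (homogeneousSubmodule σ k) (squarefreeIdeal k T) d = #T := by
  rw [hilbertFunction_squarefreeIdeal, ← card_map squarefreeExponent.toEmbedding,
    ← Set.ncard_coe_finset]
  congr 1
  ext a
  rw [mem_coe, mem_map]
  constructor
  · rintro ⟨ha, F, hF, hFa⟩
    obtain ⟨b, rfl⟩ := exists_add_of_le hFa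
    rw [map_add, degree_squarefreeExponent, hT hF, Nat.add_eq_left,
      Finsupp.degree_eq_zero_iff] at ha
    exact ⟨F, hF, by rw [ha, add_zero]; rfl⟩
  · rintro ⟨F, hF, rfl⟩
    exact ⟨(degree_squarefreeExponent F).trans (hT hF), F, hF, le_rfl⟩

theorem hilbertFunction_squarefreeIdeal_succ [Fintype σ] [DecidableEq σ] {T : Finset (Finset σ)}
    (hT : (T : Set (Finset σ)).Sized d) :
    hilbertFunction (homogeneousSubmodule σ k) (squarefreeIdeal k T) (d + 1) =
      d * #T + #(∂⁺ T) :=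
  (hilbertFunction_squarefreeIdeal _ _).trans (ncard_degree_eq_succ_and_squarefreeExponent_le hT)

theorem card_upShadow_le_of_isGotzmann [Fintype σ] [DecidableEq σ] {T W : Finset (Finset σ)}
    (hT : (T : Set (Finset σ)).Sized d)
    (hG : IsGotzmann (homogeneousSubmodule σ k) d (squarefreeIdeal k (T : Set (Finset σ))))
    (hW : (W : Set (Finset σ)).Sized d) (hTW : #T = #W) : #(∂⁺ T) ≤ #(∂⁺ W) := by
  have h := hG.2.2 (squarefreeIdeal k W) (isGeneratedInDegree_squarefreeIdeal hW).isHomogeneous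
  rw [hilbertFunction_squarefreeIdeal_self hT, hilbertFunction_squarefreeIdeal_self hW,
    hilbertFunction_squarefreeIdeal_succ hT, hilbertFunction_squarefreeIdeal_succ hW, hTW] at h
  exact Nat.le_of_add_le_add_left (h rfl)

end SquarefreeIdeals

section KruskalKatonaRing

open Finset
open scoped FinsetFamily

variable {k : Type*} [Field k] {n : ℕ}

theorem squaresIdeal_eq_span_monomial :
    squaresIdeal k n =
      Ideal.span ((fun s => monomial s 1) '' Set.range fun i => Finsupp.single i 2) := by
  rw [squaresIdeal, ← Set.range_comp]
  simp only [X_pow_eq_monomial, Function.comp_def]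

open Classical in
/-- The family of the sets `F` of size `j` for which `∏ i ∈ F, x_i` is the leading monomial of
some polynomial that is homogeneous of degree `j` and represents an element of `J`. -/
noncomputable def leadingSets (m : MonomialOrder (Fin n)) (J : Ideal (KruskalKatonaRing k n))
    (j : ℕ) : Finset (Finset (Fin n)) :=
  {F | squarefreeExponent F ∈ leadingExponents m
    ((J.comap (Ideal.Quotient.mk (squaresIdeal k n))).restrictScalars k ⊓
      homogeneousSubmodule (Fin n) k j)}

variable {m : MonomialOrder (Fin n)} {J : Ideal (KruskalKatonaRing k n)} {j : ℕ}

theorem mem_leadingSets {F : Finset (Fin n)} :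
    F ∈ leadingSets m J j ↔ squarefreeExponent F ∈ leadingExponents m
      ((J.comap (Ideal.Quotient.mk (squaresIdeal k n))).restrictScalars k ⊓
        homogeneousSubmodule (Fin n) k j) := by
  simp [leadingSets]

theorem sized_leadingSets : (leadingSets m J j : Set (Finset (Fin n))).Sized j := fun F hF =>
  (degree_squarefreeExponent F).symm.trans
    (degree_eq_of_mem_leadingExponents m (mem_leadingSets.1 hF))

theorem upShadow_leadingSets_subset : ∂⁺ (leadingSets m J j) ⊆ leadingSets m J (j + 1) := by
  intro G hG
  obtain ⟨F, hF, i, hi, rfl⟩ := mem_upShadow_iff.1 hG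
  rw [mem_leadingSets, squarefreeExponent_insert hi]
  exact add_mem_leadingExponents m (mem_leadingSets.1 hF) (Finsupp.degree_single i 1)

theorem leadingExponents_squaresIdeal :
    leadingExponents m ((squaresIdeal k n).restrictScalars k ⊓ homogeneousSubmodule (Fin n) k j) =
      {a | a.degree = j ∧ ∃ i, 2 ≤ a i} := by
  rw [squaresIdeal_eq_span_monomial, restrictScalars_span_monomial_inf_homogeneousSubmodule,
    leadingExponents_restrictSupport]
  simp only [Set.exists_range_iff, Finsupp.single_le_iff]

theorem leadingExponents_comap_diff_leadingExponents_squaresIdeal :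
    leadingExponents m ((J.comap (Ideal.Quotient.mk (squaresIdeal k n))).restrictScalars k ⊓
        homogeneousSubmodule (Fin n) k j) \
      leadingExponents m ((squaresIdeal k n).restrictScalars k ⊓
        homogeneousSubmodule (Fin n) k j) = squarefreeExponent '' (leadingSets m J j) := by
  rw [leadingExponents_squaresIdeal]
  ext a
  constructor
  · rintro ⟨ha, hsq⟩
    obtain ⟨F, rfl⟩ := mem_range_squarefreeExponent_iff.2 fun i =>
      Nat.le_of_not_gt fun hi => hsq ⟨degree_eq_of_mem_leadingExponents m ha, i, hi⟩
    exact ⟨F, mem_leadingSets.2 ha, rfl⟩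
  · rintro ⟨F, hF, rfl⟩
    exact ⟨mem_leadingSets.1 hF, fun ⟨_, i, hi⟩ =>
      (mem_range_squarefreeExponent_iff.1 ⟨F, rfl⟩ i).not_gt hi⟩

theorem hilbertFunction_kruskalKatonaGrading (m : MonomialOrder (Fin n))
    (J : Ideal (KruskalKatonaRing k n)) (j : ℕ) :
    hilbertFunction (kruskalKatonaGrading k n) J j = #(leadingSets m J j) := by
  have : Module.Finite k (homogeneousSubmodule (Fin n) k j) :=
    Module.Finite.iff_fg.2 (homogeneousSubmodule_fg _ _ j)
  have rank_nullity := hilbertFunction_quotientGrading_add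
    (𝒜 := homogeneousSubmodule (Fin n) k) (squaresIdeal k n) J j
  simp only [hilbertFunction.eq_1 (homogeneousSubmodule (Fin n) k),
    finrank_eq_ncard_leadingExponents m] at rank_nullity
  have squares_le : (squaresIdeal k n).restrictScalars k ≤
      (J.comap (Ideal.Quotient.mk (squaresIdeal k n))).restrictScalars k :=
    Ideal.mk_ker.ge.trans (Ideal.ker_le_comap _)
  have ncard_diff := Set.ncard_sdiff_add_ncard_of_subset
    (leadingExponents_mono m (inf_le_inf_right (homogeneousSubmodule (Fin n) k j) squares_le))
    ((Finsupp.finite_of_degree_eq j).subset fun a ha => degree_eq_of_mem_leadingExponents m ha)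
  rw [leadingExponents_comap_diff_leadingExponents_squaresIdeal,
    Set.ncard_image_of_injective _ squarefreeExponent.injective, Set.ncard_coe_finset]
    at ncard_diff
  exact Nat.add_right_cancel (rank_nullity.trans ncard_diff.symm)

theorem mem_leadingSets_map_squarefreeIdeal {S : Set (Finset (Fin n))} {G : Finset (Fin n)} :
    G ∈ leadingSets m ((squarefreeIdeal k S).map (Ideal.Quotient.mk (squaresIdeal k n))) j ↔
      #G = j ∧ ∃ F ∈ S, F ⊆ G := by
  have not_two_le (i : Fin n) : ¬ 2 ≤ squarefreeExponent G i :=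
    (mem_range_squarefreeExponent_iff.1 ⟨G, rfl⟩ i).not_gt
  rw [mem_leadingSets, Ideal.comap_map_of_surjective' _ Ideal.Quotient.mk_surjective, Ideal.mk_ker,
    squaresIdeal_eq_span_monomial, squarefreeIdeal_eq_span_monomial, ← Ideal.span_union,
    ← Set.image_union, restrictScalars_span_monomial_inf_homogeneousSubmodule,
    leadingExponents_restrictSupport]
  simp only [Set.mem_ofPred_eq, degree_squarefreeExponent, Set.mem_union, or_and_right, exists_or,
    Set.exists_mem_image, squarefreeExponent.le_iff_le, Set.exists_range_iff,
    Finsupp.single_le_iff, not_two_le, exists_false, or_false]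

variable {T : Finset (Finset (Fin n))} {d : ℕ}

theorem leadingSets_map_squarefreeIdeal_self (hT : (T : Set (Finset (Fin n))).Sized d) :
    leadingSets m
      ((squarefreeIdeal k (T : Set (Finset (Fin n)))).map (Ideal.Quotient.mk (squaresIdeal k n)))
      d = T := by
  ext G
  rw [mem_leadingSets_map_squarefreeIdeal]
  constructor
  · rintro ⟨hG, F, hF, hFG⟩
    rwa [← eq_of_subset_of_card_le hFG (hG.trans (hT hF).symm).le]
  · exact fun hG => ⟨hT hG, G, hG, Subset.rfl⟩

theorem leadingSets_map_squarefreeIdeal_succ (hT : (T : Set (Finset (Fin n))).Sized d) :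
    leadingSets m
      ((squarefreeIdeal k (T : Set (Finset (Fin n)))).map (Ideal.Quotient.mk (squaresIdeal k n)))
      (d + 1) = ∂⁺ T := by
  ext G
  rw [mem_leadingSets_map_squarefreeIdeal, mem_upShadow_iff_exists_mem_card_add_one]
  constructor
  · rintro ⟨hG, F, hF, hFG⟩
    exact ⟨F, hF, hFG, by rw [hG, hT hF]⟩
  · rintro ⟨F, hF, hFG, hG⟩
    exact ⟨by rw [hG, hT hF], F, hF, hFG⟩

theorem isGotzmann_map_squarefreeIdeal (hT : (T : Set (Finset (Fin n))).Sized d)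
    (hmin : ∀ W : Finset (Finset (Fin n)), (W : Set (Finset (Fin n))).Sized d → #T = #W →
      #(∂⁺ T) ≤ #(∂⁺ W)) :
    IsGotzmann (kruskalKatonaGrading k n) d
      ((squarefreeIdeal k (T : Set (Finset (Fin n)))).map
        (Ideal.Quotient.mk (squaresIdeal k n))) := by
  have generated := (isGeneratedInDegree_squarefreeIdeal (k := k) hT).map_mk (squaresIdeal k n)
  refine ⟨generated.isHomogeneous, generated, fun J _ hJ => ?_⟩
  simp only [hilbertFunction_kruskalKatonaGrading MonomialOrder.lex,
    leadingSets_map_squarefreeIdeal_self hT, leadingSets_map_squarefreeIdeal_succ hT] at hJ ⊢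
  exact (hmin _ sized_leadingSets hJ).trans (card_le_card upShadow_leadingSets_subset)

theorem IsSquarefreeMonomialIdeal.exists_sized_eq_squarefreeIdeal
    {I : Ideal (MvPolynomial (Fin n) k)} (hI : IsSquarefreeMonomialIdeal I)
    (hd : IsGeneratedInDegree (homogeneousSubmodule (Fin n) k) d I) :
    ∃ T : Finset (Finset (Fin n)), (T : Set (Finset (Fin n))).Sized d ∧
      I = squarefreeIdeal k (T : Set (Finset (Fin n))) := by
  classical
  obtain ⟨S, rfl⟩ := hI
  refine ⟨{F ∈ S | #F = d}.toFinset, fun F hF => ?_, ?_⟩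
  · exact (Set.mem_toFinset.1 hF).2
  · rw [Set.coe_toFinset]
    exact IsGeneratedInDegree.squarefreeIdeal_eq hd

end KruskalKatonaRing

end Gotzmann

theorem mainTheorem5 (k : Type*) [Field k] (n d : ℕ) (I : Ideal (MvPolynomial (Fin n) k))
    (hI : Gotzmann.IsSquarefreeMonomialIdeal I)
    (hG : Gotzmann.IsGotzmann (MvPolynomial.homogeneousSubmodule (Fin n) k) d I) :
    Gotzmann.IsGotzmann (Gotzmann.kruskalKatonaGrading k n) d
      (I.map (Ideal.Quotient.mk (Gotzmann.squaresIdeal k n))) := by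
  obtain ⟨T, hT, rfl⟩ := hI.exists_sized_eq_squarefreeIdeal hG.2.1
  exact Gotzmann.isGotzmann_map_squarefreeIdeal hT fun W hW hTW =>
    Gotzmann.card_upShadow_le_of_isGotzmann hT hG hW hTW
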